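/- Let $X$ and $Y$ be sofic shifts and let $\phi : X \to Y$ be a factor code. Then the set $$\mathcal S(\phi) = \{\, h(\phi_1(X)) : \phi = \phi_2 \circ \phi_1 \text{ with } \phi_1 \text{ and } \phi_2 \text{ factor codes between shift spaces} \,\}$$ is a dense subset of the interval $[h(Y), h(X)]$. Here a shift space is a closed subset of $\mathcal A^{\mathbb Z}$, for a finite alphabet $\mathcal A$, that is invariant under the shift $\sigma$; a factor code is a continuous surjective map between shift spaces that commutes with $\sigma$; a shift of finite type is a shift space defined by forbidding a set of words, all of the same length; a sofic shift is a shift space that is the image of a shift of finite type under a factor code; and $h(X) = \lim_{n \to \infty} \frac1n \log |\mathcal B_n(X)|$ is the entropy of a shift space $X$, where $\mathcal B_n(X)$ is the set of words of length $n$ that appear in the points of $X$ (with $h(\emptyset) = 0$ by convention). -/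

import Mathlib

open Filter Topology

universe u

namespace SymbDyn

/-- A shift space (subshift) over the alphabet `A`: a closed shift-invariant subset of `ℤ → A`.
The alphabet is finite and discrete wherever this is used. -/
abbrev ShiftSpace (A : Type u) [TopologicalSpace A] : Type u :=
  SymbolicDynamics.FullShift.Subshift A ℤ

/-- The shift map `σ` of a shift space, `(σ x)_i = x_{i+1}`. -/
def sigma {A : Type u} [TopologicalSpace A] (X : ShiftSpace A) : X.carrier → X.carrier :=
  (X.mapsTo 1).restrict

/-- A code is a continuous map between shift spaces that commutes with the shift maps. -/
def IsCode {A B : Type u} [TopologicalSpace A] [TopologicalSpace B]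
    {X : ShiftSpace A} {Y : ShiftSpace B} (φ : X.carrier → Y.carrier) : Prop :=
  Continuous φ ∧ Function.Semiconj φ (sigma X) (sigma Y)

/-- A factor code is a surjective code. -/
def IsFactorCode {A B : Type u} [TopologicalSpace A] [TopologicalSpace B]
    {X : ShiftSpace A} {Y : ShiftSpace B} (φ : X.carrier → Y.carrier) : Prop :=
  IsCode φ ∧ Function.Surjective φ

/-- The word of length `n` appearing in the sequence `x` at position `i`. -/
def wordAt {A : Type u} (x : ℤ → A) (i : ℤ) (n : ℕ) : Fin n → A :=
  fun j => x (i + (j : ℤ))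

/-- The set `B_n(X)` of the words of length `n` appearing in the points of `X`. -/
def words {A : Type u} [TopologicalSpace A] (X : ShiftSpace A) (n : ℕ) : Set (Fin n → A) :=
  {w | ∃ x ∈ X.carrier, ∃ i : ℤ, wordAt x i n = w}

/-- Shifts of finite type: for some `k`, the points of `X` are exactly the sequences that contain
no word of a set `F` of forbidden words of length `k + 1`. -/
def IsFiniteType {A : Type u} [TopologicalSpace A] (X : ShiftSpace A) : Prop :=
  ∃ (k : ℕ) (F : Set (Fin (k + 1) → A)), X.carrier = {x | ∀ i : ℤ, wordAt x i (k + 1) ∉ F}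

/-- Sofic shifts: factors of shifts of finite type over a finite alphabet. -/
def IsSofic {A : Type u} [TopologicalSpace A] (X : ShiftSpace A) : Prop :=
  ∃ (C : Type u) (_ : Finite C) (_ : TopologicalSpace C) (_ : DiscreteTopology C)
    (W : ShiftSpace C) (π : W.carrier → X.carrier), IsFiniteType W ∧ IsFactorCode π

/-- The entropy `h(X) = lim (1/n) log |B_n(X)|` of a shift space. The limit exists, see
`tendsto_entropy`; the empty shift space gets the value `0`. -/
noncomputable def entropy {A : Type u} [TopologicalSpace A] (X : ShiftSpace A) : ℝ :=
  limUnder atTop (fun n : ℕ => Real.log ((words X n).ncard : ℝ) / (n : ℝ))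

/-- The set `S(φ)` of the entropies `h(φ₁(X))` over all decompositions `φ = φ₂ ∘ φ₁` into factor
codes `φ₁ : X → Z` and `φ₂ : Z → Y`; here `φ₁(X) = Z` as `φ₁` is surjective, and `Z` runs through
all shift spaces over finite alphabets. -/
def intermediateEntropies {A B : Type u} [TopologicalSpace A] [TopologicalSpace B]
    {X : ShiftSpace A} {Y : ShiftSpace B} (φ : X.carrier → Y.carrier) : Set ℝ :=
  {h | ∃ (C : Type u) (_ : Finite C) (_ : TopologicalSpace C) (_ : DiscreteTopology C)
    (Z : ShiftSpace C) (φ₁ : X.carrier → Z.carrier) (φ₂ : Z.carrier → Y.carrier),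
    IsFactorCode φ₁ ∧ IsFactorCode φ₂ ∧ φ = φ₂ ∘ φ₁ ∧ h = entropy Z}

/-! The limit in the definition of the entropy exists. -/

theorem ncard_words_add_le {A : Type u} [TopologicalSpace A] [Finite A] (X : ShiftSpace A)
    (m n : ℕ) : (words X (m + n)).ncard ≤ (words X m).ncard * (words X n).ncard := by
  rw [← Set.ncard_prod]
  refine Set.ncard_le_ncard_of_injOn
    (fun w => (fun j => w (Fin.castAdd n j), fun j => w (Fin.natAdd m j))) ?_ ?_ (Set.toFinite _)
  · rintro w ⟨x, hx, i, rfl⟩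
    refine ⟨⟨x, hx, i, ?_⟩, ⟨x, hx, i + m, ?_⟩⟩
    · funext j
      simp [wordAt]
    · funext j
      simp [wordAt, add_assoc]
  · intro v _ w _ hvw
    simp only [Prod.mk.injEq] at hvw
    funext j
    refine Fin.addCases (fun a => congrFun hvw.1 a) (fun a => congrFun hvw.2 a) j

theorem tendsto_entropy {A : Type u} [TopologicalSpace A] [Finite A] (X : ShiftSpace A) :
    Tendsto (fun n : ℕ => Real.log ((words X n).ncard : ℝ) / (n : ℝ)) atTop (𝓝 (entropy X)) := by
  refine tendsto_nhds_limUnder ?_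
  rcases X.carrier.eq_empty_or_nonempty with h0 | ⟨x, hx⟩
  · refine ⟨0, ?_⟩
    have : ∀ n, words X n = ∅ := fun n => by simp [words, h0]
    simp [this]
  · have hpos : ∀ n, 0 < (words X n).ncard := fun n =>
      (Set.ncard_pos (Set.toFinite _)).2 ⟨_, x, hx, 0, rfl⟩
    have hsub : Subadditive (fun n : ℕ => Real.log ((words X n).ncard : ℝ)) := by
      intro m n
      have h1 := hpos m
      have h2 := hpos n
      have h3 := hpos (m + n)
      rw [← Real.log_mul (by positivity) (by positivity)]
      refine Real.log_le_log (by positivity) ?_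
      exact_mod_cast ncard_words_add_le X m n
    refine ⟨hsub.lim, hsub.tendsto_lim ⟨0, ?_⟩⟩
    rintro _ ⟨n, rfl⟩
    exact div_nonneg (Real.log_natCast_nonneg _) (Nat.cast_nonneg n)

end SymbDyn

open SymbolicDynamics.FullShift Filter Topology

/-! Keep `φ x` and also mark where `x` shows a word from a set `S` of words of length `L`: each
marked shift is an intermediate factor. Only words with no positive period below `N` are allowed in
`S`. Growing `S` one word at a time moves the entropy from at most `h(Y)` to nearly `h(X)` in small
steps, so some value lands near each target.

The steps are small because occurrences of such a word are at least `N` apart, so a new mark costs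
at most `log (N + 1) / N` (`entropy_markedShift_insert_le`). Once all these words are marked, the
marks reveal `x` except at positions all of whose windows have a small period. There `x` continues
periodically, so one period per block of length `L` recovers it, a loss of order `1 / L` for fixed
`N` (`entropy_le_entropy_markedShift`). Hence `N` is chosen first, then `L`. -/

namespace SymbDyn

/-! ### Entropy bounds from counting words -/

section Counting

variable {A B : Type u} [TopologicalSpace A] [TopologicalSpace B]

/-- If the words of length `n` of `W` are determined by words of length `n + 2 * c` of `Z` together
with an element of a finite type `E`, then `W` has at most `|B_{n + 2c}(Z)| * |E|` of them. -/
theorem ncard_words_le_of_determined [Finite A] [Finite B] {Z : ShiftSpace A} {W : ShiftSpace B}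
    {I E : Type*} [Finite E] (f : I → Z.carrier) (g : I → W.carrier)
    (hg : Function.Surjective g) (n c : ℕ) (R : I → ℤ → E → Prop) (hR : ∀ x i, ∃ e, R x i e)
    (hdet : ∀ x x' i i' e, (∀ k : ℤ, -c ≤ k → k < n + c → (f x).1 (i + k) = (f x').1 (i' + k)) →
      R x i e → R x' i' e → ∀ k : ℤ, 0 ≤ k → k < n → (g x).1 (i + k) = (g x').1 (i' + k)) :
    (words W n).ncard ≤ (words Z (n + 2 * c)).ncard * Nat.card E := by
  choose e he using hR
  have hw : ∀ w : words W n, ∃ (x : I) (i : ℤ), wordAt (g x).1 i n = w.1 := by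
    rintro ⟨w, y, hy, i, hi⟩
    obtain ⟨x, hx⟩ := hg ⟨y, hy⟩
    exact ⟨x, i, by rw [hx]; exact hi⟩
  choose x i hxi using hw
  rw [← Set.ncard_univ E, ← Set.ncard_prod, ← Nat.card_coe_set_eq, ← Nat.card_coe_set_eq]
  have : Finite ((words Z (n + 2 * c)) ×ˢ (Set.univ : Set E) : Set _) := Set.toFinite _
  refine Nat.card_le_card_of_injective
    (fun w => ⟨(wordAt (f (x w)).1 (i w - c) (n + 2 * c), e (x w) (i w)),
      ⟨_, (f (x w)).2, _, rfl⟩, trivial⟩) ?_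
  intro v w hvw
  have h1 := congrArg (fun p => p.1.1) hvw
  have h2 := congrArg (fun p => p.1.2) hvw
  dsimp only at h1 h2
  apply Subtype.ext
  rw [← hxi v, ← hxi w]
  funext j
  refine hdet (x v) (x w) (i v) (i w) (e (x v) (i v)) ?_ (he _ _) (h2 ▸ he _ _) j
    (by positivity) (by exact_mod_cast j.2)
  intro k hk1 hk2
  have := congrFun h1 ⟨(k + c).toNat, by omega⟩
  simp only [wordAt] at this
  have h3 : (((k + c).toNat : ℕ) : ℤ) = k + c := Int.toNat_of_nonneg (by omega)
  rw [h3] at this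
  convert this using 2 <;> ring

/-- After taking logarithms and dividing by `n`, the extra length `c` vanishes in the limit and one
factor `K` per block of length `L` leaves `log K / L`. -/
theorem entropy_le_of_ncard_le [Finite A] [Finite B] {Z : ShiftSpace A} {W : ShiftSpace B}
    (c K L : ℕ) (hK : 0 < K) (hL : 0 < L)
    (h : ∀ n, (words W n).ncard ≤ (words Z (n + c)).ncard * K ^ (n / L + 1)) :
    entropy W ≤ entropy Z + Real.log K / L := by
  have hK' : 0 ≤ Real.log K := Real.log_natCast_nonneg K
  have hlim : Tendsto (fun n : ℕ => Real.log ((words Z (n + c)).ncard : ℝ) / ((n + c : ℕ) : ℝ) *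
      (1 + c / (n : ℝ)) + (Real.log K / L + Real.log K / (n : ℝ))) atTop
      (𝓝 (entropy Z * (1 + 0) + (Real.log K / L + 0))) := by
    refine (((tendsto_entropy Z).comp (tendsto_add_atTop_nat c)).mul ?_).add ?_
    · exact tendsto_const_nhds.add (tendsto_const_div_atTop_nhds_zero_nat _)
    · exact tendsto_const_nhds.add (tendsto_const_div_atTop_nhds_zero_nat _)
  simp only [add_zero, mul_one] at hlim
  refine le_of_tendsto_of_tendsto (tendsto_entropy W) hlim ?_
  filter_upwards [eventually_gt_atTop 0] with n hn
  have hn' : (0 : ℝ) < n := by exact_mod_cast hn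
  have hlog : Real.log ((words W n).ncard : ℝ) ≤
      Real.log ((words Z (n + c)).ncard : ℝ) + ((n / L : ℕ) + 1) * Real.log K := by
    rcases Nat.eq_zero_or_pos (words W n).ncard with h0 | h0
    · rw [h0]
      have := Real.log_natCast_nonneg (words Z (n + c)).ncard
      simp only [Nat.cast_zero, Real.log_zero]
      positivity
    · have hZ : 0 < (words Z (n + c)).ncard := by
        rcases Nat.eq_zero_or_pos (words Z (n + c)).ncard with h1 | h1
        · have := h n
          rw [h1, zero_mul] at this
          omega
        · exact h1
      have h2 : ((words W n).ncard : ℝ) ≤ (words Z (n + c)).ncard * (K : ℝ) ^ (n / L + 1) := by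
        exact_mod_cast h n
      have := Real.log_le_log (by exact_mod_cast h0) h2
      rw [Real.log_mul (by positivity) (by positivity), Real.log_pow] at this
      exact_mod_cast this
  have hdiv : ((n / L : ℕ) : ℝ) ≤ n / L := Nat.cast_div_le
  have hnc : ((n + c : ℕ) : ℝ) ≠ 0 := by positivity
  have hL' : (L : ℝ) ≠ 0 := by positivity
  have e1 : Real.log ((words Z (n + c)).ncard : ℝ) / ((n + c : ℕ) : ℝ) * (1 + c / (n : ℝ)) +
      (Real.log K / L + Real.log K / (n : ℝ)) =
      (Real.log ((words Z (n + c)).ncard : ℝ) + ((n : ℝ) / L + 1) * Real.log K) / n := by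
    push_cast at hnc ⊢
    field_simp
  rw [e1]
  gcongr
  refine hlog.trans ?_
  gcongr

end Counting

/-! ### Codes as sliding block codes -/

section Codes

variable {A B : Type u} [TopologicalSpace A] [TopologicalSpace B]

/-- The shift by `i` on the points of a shift space. -/
def shiftBy (X : ShiftSpace A) (i : ℤ) : X.carrier → X.carrier :=
  (X.mapsTo i).restrict

theorem shiftBy_apply (X : ShiftSpace A) (i : ℤ) (x : X.carrier) (j : ℤ) :
    (shiftBy X i x).1 j = x.1 (i + j) := rfl

theorem shiftBy_shiftBy (X : ShiftSpace A) (i j : ℤ) (x : X.carrier) :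
    shiftBy X i (shiftBy X j x) = shiftBy X (j + i) x := by
  apply Subtype.ext
  funext k
  simp only [shiftBy_apply, add_assoc]

theorem shiftBy_zero (X : ShiftSpace A) (x : X.carrier) : shiftBy X 0 x = x := by
  apply Subtype.ext
  funext k
  simp only [shiftBy_apply, zero_add]

theorem IsCode.map_shiftBy {X : ShiftSpace A} {Y : ShiftSpace B} {φ : X.carrier → Y.carrier}
    (hφ : IsCode φ) (i : ℤ) (x : X.carrier) : φ (shiftBy X i x) = shiftBy Y i (φ x) := by
  have h1 : ∀ x, φ (shiftBy X 1 x) = shiftBy Y 1 (φ x) := hφ.2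
  have h2 : ∀ x, φ (shiftBy X (-1) x) = shiftBy Y (-1) (φ x) := by
    intro x
    have := h1 (shiftBy X (-1) x)
    rw [shiftBy_shiftBy, neg_add_cancel, shiftBy_zero] at this
    rw [this, shiftBy_shiftBy, add_neg_cancel, shiftBy_zero]
  induction i generalizing x with
  | zero => rw [shiftBy_zero, shiftBy_zero]
  | succ n ih => rw [← shiftBy_shiftBy, h1, ih, shiftBy_shiftBy]
  | pred n ih => rw [sub_eq_add_neg, ← shiftBy_shiftBy, h2, ih, shiftBy_shiftBy]

/-- Codes are sliding block codes. -/
theorem IsCode.exists_window [Finite A] [DiscreteTopology A] [DiscreteTopology B]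
    {X : ShiftSpace A} {Y : ShiftSpace B} {φ : X.carrier → Y.carrier} (hφ : IsCode φ) :
    ∃ m : ℕ, ∀ (x y : X.carrier) (i j : ℤ),
      (∀ k : ℤ, -m ≤ k → k ≤ m → x.1 (i + k) = y.1 (j + k)) → (φ x).1 i = (φ y).1 j := by
  suffices h : ∃ m : ℕ, ∀ x y : X.carrier,
      (∀ k : ℤ, -m ≤ k → k ≤ m → x.1 k = y.1 k) → (φ x).1 0 = (φ y).1 0 by
    obtain ⟨m, hm⟩ := h
    refine ⟨m, fun x y i j hxy => ?_⟩
    have := hm (shiftBy X i x) (shiftBy X j y) hxy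
    rw [hφ.map_shiftBy, hφ.map_shiftBy] at this
    simpa only [shiftBy_apply, add_zero] using this
  by_contra! hcon
  have : CompactSpace X.carrier := isCompact_iff_compactSpace.1 X.isClosed.isCompact
  have hc : ∀ k : ℤ, Continuous fun x : X.carrier => x.1 k := fun k =>
    (continuous_apply k).comp continuous_subtype_val
  have hc0 : Continuous fun x : X.carrier => (φ x).1 0 :=
    (continuous_apply 0).comp (continuous_subtype_val.comp hφ.1)
  -- Pairs agreeing on `[-m, m]` with different images at `0`: nested nonempty compact sets, whose
  -- common point would be a pair `(x, x)`.
  let T : ℕ → Set (X.carrier × X.carrier) := fun m =>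
    (⋂ (k : ℤ) (_ : -m ≤ k ∧ k ≤ m), {p | p.1.1 k = p.2.1 k}) ∩ {p | (φ p.1).1 0 ≠ (φ p.2).1 0}
  have hT : ∀ m, IsClosed (T m) := by
    intro m
    refine IsClosed.inter (isClosed_biInter fun k _ =>
      isClosed_eq ((hc k).comp continuous_fst) ((hc k).comp continuous_snd)) ?_
    have : {p : X.carrier × X.carrier | (φ p.1).1 0 ≠ (φ p.2).1 0} =
        (fun p : X.carrier × X.carrier => ((φ p.1).1 0, (φ p.2).1 0)) ⁻¹' {q | q.1 ≠ q.2} := rfl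
    rw [this]
    exact (isClosed_discrete _).preimage
      ((hc0.comp continuous_fst).prodMk (hc0.comp continuous_snd))
  have hmono : ∀ m, T (m + 1) ⊆ T m := by
    rintro m p ⟨h1, h2⟩
    simp only [Set.mem_iInter, Set.mem_ofPred_eq] at h1
    refine ⟨?_, h2⟩
    simp only [Set.mem_iInter, Set.mem_ofPred_eq]
    exact fun k hk => h1 k ⟨by push_cast; omega, by push_cast; omega⟩
  obtain ⟨p, hp⟩ := IsCompact.nonempty_iInter_of_sequence_nonempty_isCompact_isClosed T hmono
    (fun m => by
      obtain ⟨x, y, hxy, hne⟩ := hcon m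
      exact ⟨(x, y), by simpa using hxy, hne⟩) (hT 0).isCompact hT
  rw [Set.mem_iInter] at hp
  refine (hp 0).2 ?_
  have : p.1 = p.2 := by
    apply Subtype.ext
    funext k
    have := (hp k.natAbs).1
    simp only [Set.mem_iInter, Set.mem_ofPred_eq] at this
    exact this k ⟨by omega, by omega⟩
  rw [this]

/-- Factor codes do not increase entropy. -/
theorem IsFactorCode.entropy_le [Finite A] [Finite B] [DiscreteTopology A] [DiscreteTopology B]
    {X : ShiftSpace A} {Y : ShiftSpace B} {φ : X.carrier → Y.carrier} (hφ : IsFactorCode φ) :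
    entropy Y ≤ entropy X := by
  obtain ⟨m, hm⟩ := hφ.1.exists_window
  have := entropy_le_of_ncard_le (W := Y) (Z := X) (2 * m) 1 1 one_pos one_pos fun n => by
    have := ncard_words_le_of_determined (E := Unit) id φ hφ.2 n m (fun _ _ _ => True)
      (fun _ _ => ⟨(), trivial⟩) fun x x' i i' _ h _ _ k hk1 hk2 => hm x x' _ _ fun l hl1 hl2 => by
        rw [add_assoc, add_assoc]
        exact h (k + l) (by omega) (by omega)
    simpa using this
  simpa using this

end Codes

/-! ### Intermediate factors obtained by marking words -/

section Marking

variable {A B : Type u} {L : ℕ}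

/-- The alphabet of the marked sequences: a symbol, and possibly a word of length `L`. -/
def MarkedAlphabet (A B : Type u) (L : ℕ) : Type u := B × Option (Fin L → A)

instance : TopologicalSpace (MarkedAlphabet A B L) := ⊥

instance : DiscreteTopology (MarkedAlphabet A B L) := ⟨rfl⟩

instance [Finite A] [Finite B] : Finite (MarkedAlphabet A B L) :=
  inferInstanceAs (Finite (B × Option (Fin L → A)))

open Classical in
/-- The word `w` if it belongs to `S`. -/
noncomputable def mark (S : Set (Fin L → A)) (w : Fin L → A) : Option (Fin L → A) :=
  if w ∈ S then some w else none

theorem mark_of_mem {S : Set (Fin L → A)} {w : Fin L → A} (h : w ∈ S) : mark S w = some w :=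
  if_pos h

theorem mark_of_notMem {S : Set (Fin L → A)} {w : Fin L → A} (h : w ∉ S) : mark S w = none :=
  if_neg h

theorem eq_of_mark_eq {S : Set (Fin L → A)} {v w : Fin L → A} (hv : v ∈ S)
    (h : mark S v = mark S w) : v = w := by
  rw [mark_of_mem hv] at h
  by_cases hw : w ∈ S
  · rw [mark_of_mem hw] at h
    exact Option.some.inj h
  · rw [mark_of_notMem hw] at h
    cases h

/-- Beyond the old mark, the new one needs a single bit: whether the word is `u`. -/
theorem mark_insert_eq {S : Set (Fin L → A)} {u v w : Fin L → A} (h : mark S v = mark S w)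
    (hu : v = u ↔ w = u) : mark (insert u S) v = mark (insert u S) w := by
  by_cases hv : v ∈ S
  · rw [eq_of_mark_eq hv h]
  by_cases hw : w ∈ S
  · rw [eq_of_mark_eq hw h.symm]
  by_cases hvu : v = u
  · rw [hvu, hu.1 hvu]
  · rw [mark_of_notMem (by simp [hvu, hv]), mark_of_notMem (by simp [← hu, hvu, hw])]

variable [TopologicalSpace A] [TopologicalSpace B]

/-- The point `φ x` together with the marks of the occurrences in `x` of words in `S`. -/
noncomputable def markedPoint {X : ShiftSpace A} {Y : ShiftSpace B} (φ : X.carrier → Y.carrier)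
    (S : Set (Fin L → A)) (x : X.carrier) : ℤ → MarkedAlphabet A B L :=
  fun i => ((φ x).1 i, mark S (wordAt x.1 i L))

theorem continuous_wordAt (i : ℤ) : Continuous fun x : ℤ → A => wordAt x i L := by
  unfold wordAt
  fun_prop

theorem IsCode.continuous_markedPoint [Finite A] [DiscreteTopology A] [DiscreteTopology B]
    {X : ShiftSpace A} {Y : ShiftSpace B} {φ : X.carrier → Y.carrier} (hφ : IsCode φ)
    (S : Set (Fin L → A)) : Continuous (markedPoint φ S) := by
  refine continuous_pi fun i => ?_
  have h : Continuous fun x : X.carrier => ((φ x).1 i, wordAt x.1 i L) :=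
    ((continuous_apply i).comp (continuous_subtype_val.comp hφ.1)).prodMk
      ((continuous_wordAt i).comp continuous_subtype_val)
  exact (continuous_of_discreteTopology
    (f := fun p : B × (Fin L → A) =>
      (show MarkedAlphabet A B L from (p.1, mark S p.2)))).comp h

theorem IsCode.markedPoint_shiftBy {X : ShiftSpace A} {Y : ShiftSpace B}
    {φ : X.carrier → Y.carrier} (hφ : IsCode φ) (S : Set (Fin L → A)) (i : ℤ) (x : X.carrier) :
    markedPoint φ S (shiftBy X i x) = shift i (markedPoint φ S x) := by
  funext j
  have h : wordAt (shiftBy X i x).1 j L = wordAt x.1 (i + j) L := by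
    funext k
    simp only [wordAt, shiftBy_apply, add_assoc]
  simp only [markedPoint, hφ.map_shiftBy, shift_apply, shiftBy_apply, h]
  rfl

variable [Finite A] [DiscreteTopology A] [DiscreteTopology B]
  {X : ShiftSpace A} {Y : ShiftSpace B} {φ : X.carrier → Y.carrier}

/-- The shift space of all marked points. -/
noncomputable def markedShift (hφ : IsCode φ) (S : Set (Fin L → A)) :
    ShiftSpace (MarkedAlphabet A B L) where
  carrier := Set.range (markedPoint φ S)
  isClosed := by
    have : CompactSpace X.carrier := isCompact_iff_compactSpace.1 X.isClosed.isCompact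
    exact (isCompact_range (hφ.continuous_markedPoint S)).isClosed
  mapsTo := by
    rintro i _ ⟨x, rfl⟩
    exact ⟨shiftBy X i x, hφ.markedPoint_shiftBy S i x⟩

/-- The factor code that marks the words in `S`. -/
noncomputable def markedCode (hφ : IsCode φ) (S : Set (Fin L → A)) :
    X.carrier → (markedShift hφ S).carrier :=
  fun x => ⟨markedPoint φ S x, x, rfl⟩

theorem markedCode_surjective (hφ : IsCode φ) (S : Set (Fin L → A)) :
    Function.Surjective (markedCode hφ S) := by
  rintro ⟨_, x, rfl⟩
  exact ⟨x, rfl⟩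

theorem isFactorCode_markedCode (hφ : IsCode φ) (S : Set (Fin L → A)) :
    IsFactorCode (markedCode hφ S) :=
  ⟨⟨(hφ.continuous_markedPoint S).subtype_mk _,
    fun x => Subtype.ext (hφ.markedPoint_shiftBy S 1 x)⟩, markedCode_surjective hφ S⟩

/-- Forgetting the marks is the second factor code. -/
theorem entropy_markedShift_mem [Finite B] (hφ : IsFactorCode φ) (S : Set (Fin L → A)) :
    entropy (markedShift hφ.1 S) ∈ intermediateEntropies φ := by
  have hmem : ∀ z : (markedShift hφ.1 S).carrier, (fun i => (z.1 i).1) ∈ Y.carrier := by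
    rintro ⟨_, x, rfl⟩
    exact (φ x).2
  refine ⟨MarkedAlphabet A B L, inferInstance, inferInstance, inferInstance, markedShift hφ.1 S,
    markedCode hφ.1 S, fun z => ⟨fun i => (z.1 i).1, hmem z⟩, isFactorCode_markedCode hφ.1 S,
    ⟨⟨?_, fun z => rfl⟩, ?_⟩, rfl, rfl⟩
  · refine Continuous.subtype_mk (continuous_pi fun i => ?_) _
    exact (continuous_of_discreteTopology (f := fun c : MarkedAlphabet A B L => c.1)).comp
      ((continuous_apply i).comp continuous_subtype_val)
  · intro y
    obtain ⟨x, rfl⟩ := hφ.2 y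
    exact ⟨markedCode hφ.1 S x, rfl⟩

theorem entropy_markedShift_empty_le [Finite B] (hφ : IsCode φ) :
    entropy (markedShift hφ (∅ : Set (Fin L → A))) ≤ entropy Y := by
  have := entropy_le_of_ncard_le (W := markedShift hφ (∅ : Set (Fin L → A))) (Z := Y) 0 1 1
    one_pos one_pos fun n => by
      have := ncard_words_le_of_determined (E := Unit) φ (markedCode hφ (∅ : Set (Fin L → A)))
        (markedCode_surjective hφ _) n 0 (fun _ _ _ => True) (fun _ _ => ⟨(), trivial⟩)
        fun x x' i i' _ h _ _ k hk1 hk2 => Prod.ext (h k (by simpa using hk1) (by simpa using hk2))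
          (by simp [markedCode, markedPoint, mark])
      simpa using this
  simpa using this

end Marking

/-! ### Small periods and overlapping occurrences -/

section Overlaps

variable {A : Type u} {L : ℕ}

/-- The word `w` has a positive period less than `N`. -/
def HasPeriodLT (N : ℕ) (w : Fin L → A) : Prop :=
  ∃ p : ℕ, 0 < p ∧ p < N ∧ ∀ (j : ℕ) (h : j + p < L), w ⟨j + p, h⟩ = w ⟨j, by omega⟩

/-- The distance between two distinct occurrences is a period of `w`. A period of at least `L` holds
vacuously, so disjoint occurrences are covered too. -/
theorem eq_of_wordAt_eq {N : ℕ} {w : Fin L → A} (hw : ¬ HasPeriodLT N w) {x : ℤ → A} {i j : ℤ}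
    (hi : wordAt x i L = w) (hj : wordAt x j L = w) (h1 : i < j + N) (h2 : j < i + N) :
    i = j := by
  have key : ∀ i j : ℤ, wordAt x i L = w → wordAt x j L = w → j < i + N → j ≤ i := by
    intro i j hi hj h
    by_contra! hlt
    refine hw ⟨(j - i).toNat, by omega, by omega, fun k hk => ?_⟩
    have e1 := congrFun hi ⟨k + (j - i).toNat, hk⟩
    have e2 := congrFun hj ⟨k, by omega⟩
    rw [← e1, ← e2]
    simp only [wordAt]
    congr 1
    push_cast
    omega
  exact le_antisymm (key j i hj hi h1) (key i j hi hj h2)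

theorem exists_eq_mod_of_hasPeriodLT {N : ℕ} {x : ℤ → A} {i : ℤ}
    (h : HasPeriodLT N (wordAt x i L)) :
    ∃ p : ℕ, 0 < p ∧ p < N ∧ ∀ j < L, x (i + (j : ℤ)) = x (i + ((j % p : ℕ) : ℤ)) := by
  obtain ⟨p, hp, hpN, h⟩ := h
  refine ⟨p, hp, hpN, fun j => ?_⟩
  induction j using Nat.strong_induction_on with
  | _ j ih =>
    intro hj
    by_cases hjp : j < p
    · rw [Nat.mod_eq_of_lt hjp]
    · obtain ⟨k, rfl⟩ := Nat.exists_eq_add_of_le' (not_lt.1 hjp)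
      rw [Nat.add_mod_right, ← ih k (by omega) (by omega)]
      exact h k hj

end Overlaps

/-! ### Entropy cost of one mark and of all marks -/

section Increments

variable {A B : Type u} [Finite A] [Finite B] [TopologicalSpace A] [TopologicalSpace B]
  [DiscreteTopology A] [DiscreteTopology B]
  {X : ShiftSpace A} {Y : ShiftSpace B} {φ : X.carrier → Y.carrier} {L N : ℕ}

/-- Marking one more word without small periods increases the entropy only slightly. -/
theorem entropy_markedShift_insert_le (hφ : IsCode φ) (hN : 0 < N) (S : Set (Fin L → A))
    {w : Fin L → A} (hw : ¬ HasPeriodLT N w) :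
    entropy (markedShift hφ (insert w S)) ≤
      entropy (markedShift hφ S) + Real.log (N + 1 : ℕ) / N := by
  refine entropy_le_of_ncard_le 0 (N + 1) N N.succ_pos hN fun n => ?_
  -- Each block of length `N` contains at most one occurrence of `w`; `e` records its offset, if
  -- any.
  have := ncard_words_le_of_determined (E := Fin (n / N + 1) → Option (Fin N)) (markedCode hφ S)
    (markedCode hφ (insert w S)) (markedCode_surjective hφ _) n 0
    (fun x i e => ∀ (q : Fin (n / N + 1)) (r : Fin N), wordAt x.1 (i + (q * N + r : ℕ)) L = w ↔ e q = some r) ?_ ?_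
  · simpa using this
  · intro x i
    suffices h : ∀ q : Fin (n / N + 1), ∃ o : Option (Fin N),
        ∀ r : Fin N, wordAt x.1 (i + (q * N + r : ℕ)) L = w ↔ o = some r from Classical.skolem.1 h
    intro q
    by_cases h : ∃ r : Fin N, wordAt x.1 (i + (q * N + r : ℕ)) L = w
    · obtain ⟨r, hr⟩ := h
      refine ⟨some r, fun s => ⟨fun hs => ?_, fun hs => ?_⟩⟩
      · have := eq_of_wordAt_eq hw hr hs (by push_cast; omega) (by push_cast; omega)
        congr 1
        apply Fin.ext
        push_cast at this
        omega
      · rwa [← Option.some.inj hs]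
    · push Not at h
      exact ⟨none, fun s => iff_of_false (h s) (by simp)⟩
  · intro x x' i i' e h hx hx' k hk1 hk2
    have hk := h k (by simpa using hk1) (by simpa using hk2)
    have hkn : k.toNat / N < n / N + 1 :=
      Nat.lt_succ_of_le (Nat.div_le_div_right (by omega))
    have e1 : k = ((k.toNat / N * N + k.toNat % N : ℕ) : ℤ) := by
      rw [Nat.div_add_mod']
      omega
    have h1 := hx ⟨k.toNat / N, hkn⟩ ⟨k.toNat % N, Nat.mod_lt _ hN⟩
    have h2 := hx' ⟨k.toNat / N, hkn⟩ ⟨k.toNat % N, Nat.mod_lt _ hN⟩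
    simp only [← e1] at h1 h2
    have hfst : (φ x).1 (i + k) = (φ x').1 (i' + k) := congrArg Prod.fst hk
    exact Prod.ext hfst
      (mark_insert_eq (congrArg Prod.snd hk) (h1.trans h2.symm))

/-- The windows of length `L` of `x` that contain the position `s` have small periods. -/
def Uncovered (L N : ℕ) (x : ℤ → A) (s : ℤ) : Prop :=
  ∀ d : ℕ, d < L → HasPeriodLT N (wordAt x (s - d) L)

/-- Marking all words of length `L` without small periods loses only little entropy. -/
theorem entropy_le_entropy_markedShift (hφ : IsCode φ) (hN : 0 < N) (hL : 0 < L) :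
    entropy X ≤ entropy (markedShift hφ {w : Fin L → A | ¬ HasPeriodLT N w}) +
      Real.log (N * (Nat.card A + 1) ^ N : ℕ) / L := by
  set S : Set (Fin L → A) := {w | ¬ HasPeriodLT N w} with hS
  -- The `+ 1` in the base keeps the constant positive for an empty alphabet.
  refine entropy_le_of_ncard_le (2 * L) _ L (by positivity) hL fun n => ?_
  -- For each block, `e` stores a period and the symbols from the first uncovered position `a` on.
  -- The window of length `L` from `a` reaches the end of the block, so one record suffices; an `a`
  -- beyond the block is harmless.
  have := ncard_words_le_of_determined (E := Fin (n / L + 1) → Fin N × (Fin N → A))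
    (markedCode hφ S) (id : X.carrier → X.carrier) Function.surjective_id n L
    (fun x i e => ∀ (q : Fin (n / L + 1)) (a : ℕ), Uncovered L N x.1 (i + (q * L + a : ℕ)) →
      (∀ b < a, ¬ Uncovered L N x.1 (i + (q * L + b : ℕ))) →
      ∀ j < L, ∃ h : j % (e q).1 < N, x.1 (i + (q * L + a : ℕ) + j) = (e q).2 ⟨j % (e q).1, h⟩)
    ?_ ?_
  · refine this.trans (Nat.mul_le_mul_left _ ?_)
    simp only [Nat.card_pi, Nat.card_prod, Finset.prod_const, Finset.card_univ, Fintype.card_fin,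
      Nat.card_eq_fintype_card]
    gcongr
    exact Nat.le_succ _
  · intro x i
    suffices h : ∀ q : Fin (n / L + 1), ∃ o : Fin N × (Fin N → A),
        ∀ a : ℕ, Uncovered L N x.1 (i + (q * L + a : ℕ)) →
        (∀ b < a, ¬ Uncovered L N x.1 (i + (q * L + b : ℕ))) →
        ∀ j < L, ∃ h : j % o.1 < N, x.1 (i + (q * L + a : ℕ) + j) = o.2 ⟨j % o.1, h⟩ from
      Classical.skolem.1 h
    intro q
    by_cases h : ∃ a : ℕ, Uncovered L N x.1 (i + (q * L + a : ℕ))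
    · classical
      have h0 := Nat.find_spec h
      have h0' := h0 0 hL
      rw [Nat.cast_zero, sub_zero] at h0'
      obtain ⟨p, hp, hpN, hper⟩ := exists_eq_mod_of_hasPeriodLT h0'
      refine ⟨(⟨p, hpN⟩, fun j => x.1 (i + (q * L + Nat.find h : ℕ) + (j : ℕ))), fun a ha hmin => ?_⟩
      have : a = Nat.find h := by
        refine le_antisymm (not_lt.1 fun hlt => hmin _ hlt h0) (Nat.find_min' h ha)
      subst this
      exact fun j hj => ⟨(Nat.mod_lt j hp).trans hpN, hper j hj⟩
    · exact ⟨(⟨0, hN⟩, fun _ => x.1 0), fun a ha => absurd ⟨a, ha⟩ h⟩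
  · intro x x' i i' e h hx hx' k hk1 hk2
    have hmark : ∀ l : ℤ, -L ≤ l → l < n + L →
        mark S (wordAt x.1 (i + l) L) = mark S (wordAt x'.1 (i' + l) L) :=
      fun l h1 h2 => congrArg Prod.snd (h l h1 h2)
    -- The marks decide which positions are uncovered, and a marked window displays the symbol at
    -- each position it covers.
    have hcov : ∀ l : ℤ, 0 ≤ l → l < n + L →
        ((Uncovered L N x.1 (i + l) ∧ Uncovered L N x'.1 (i' + l)) ∨
        (¬ Uncovered L N x.1 (i + l) ∧ ¬ Uncovered L N x'.1 (i' + l) ∧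
          x.1 (i + l) = x'.1 (i' + l))) := by
      intro l hl1 hl2
      by_cases hu : ∃ d : ℕ, d < L ∧ wordAt x.1 (i + l - d) L = wordAt x'.1 (i' + l - d) L ∧
          ¬ HasPeriodLT N (wordAt x.1 (i + l - d) L)
      · obtain ⟨d, hd, heq, hnp⟩ := hu
        refine Or.inr ⟨fun hc => hnp (hc d hd), fun hc => hnp (heq ▸ hc d hd), ?_⟩
        have := congrFun heq ⟨d, hd⟩
        simpa only [wordAt, sub_add_cancel] using this
      · push Not at hu
        refine Or.inl ⟨fun d hd => ?_, fun d hd => ?_⟩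
        · by_contra hnp
          have hm := hmark (l - d) (by omega) (by omega)
          rw [← add_sub_assoc, ← add_sub_assoc] at hm
          exact hnp (hu d hd (eq_of_mark_eq hnp hm))
        · by_contra hnp
          have hm := hmark (l - d) (by omega) (by omega)
          rw [← add_sub_assoc, ← add_sub_assoc] at hm
          have heq := eq_of_mark_eq hnp hm.symm
          exact hnp (heq ▸ hu d hd heq.symm)
    rcases hcov k hk1 (by omega) with ⟨hu, hu'⟩ | ⟨-, -, heq⟩
    swap
    · exact heq
    obtain ⟨m, rfl⟩ := Int.eq_ofNat_of_zero_le hk1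
    have hmn : m < n := by exact_mod_cast hk2
    have hq : m / L < n / L + 1 := Nat.lt_succ_of_le (Nat.div_le_div_right hmn.le)
    have hr : m % L < L := Nat.mod_lt _ hL
    have hdm : m / L * L + m % L = m := Nat.div_add_mod' m L
    classical
    have hex : ∃ a : ℕ, Uncovered L N x.1 (i + (m / L * L + a : ℕ)) := ⟨m % L, by rwa [hdm]⟩
    obtain ⟨a, ha, hmin⟩ : ∃ a : ℕ, Uncovered L N x.1 (i + (m / L * L + a : ℕ)) ∧
        ∀ b < a, ¬ Uncovered L N x.1 (i + (m / L * L + b : ℕ)) :=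
      ⟨Nat.find hex, Nat.find_spec hex, fun b hb => Nat.find_min hex hb⟩
    have har : a ≤ m % L := not_lt.1 fun hlt => hmin _ hlt (by rwa [hdm])
    -- Both points have the same first uncovered position, so the shared record is read at the same
    -- offset.
    have hiff : ∀ b ≤ a, Uncovered L N x.1 (i + (m / L * L + b : ℕ)) ↔
        Uncovered L N x'.1 (i' + (m / L * L + b : ℕ)) := by
      intro b hb
      rcases hcov (m / L * L + b : ℕ) (by positivity)
        (by exact_mod_cast (by omega : m / L * L + b < n + L)) with ⟨h1, h2⟩ | ⟨h1, h2, -⟩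
      · exact iff_of_true h1 h2
      · exact iff_of_false h1 h2
    obtain ⟨hlt, e1⟩ := hx ⟨m / L, hq⟩ a ha hmin (m % L - a) (by omega)
    obtain ⟨hlt', e2⟩ := hx' ⟨m / L, hq⟩ a ((hiff a le_rfl).1 ha)
      (fun b hb => (hiff b hb.le).not.1 (hmin b hb)) (m % L - a) (by omega)
    have hpos : ∀ t : ℤ, t + (m / L * L + a : ℕ) + (m % L - a : ℕ) = t + m := by
      intro t
      rw [add_assoc, ← Nat.cast_add]
      congr 2
      omega
    have e3 := e1.trans e2.symm
    simp only [hpos] at e3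
    exact e3

end Increments

/-! ### Density -/

/-- Every number between the entropies is approximated by intermediate entropies. -/
theorem exists_intermediateEntropy_near {A B : Type u} [Finite A] [Finite B]
    [TopologicalSpace A] [DiscreteTopology A] [TopologicalSpace B] [DiscreteTopology B]
    {X : ShiftSpace A} {Y : ShiftSpace B} {φ : X.carrier → Y.carrier} (hφ : IsFactorCode φ)
    {t ε : ℝ} (hε : 0 < ε) (hY : entropy Y ≤ t) (hX : t ≤ entropy X) :
    ∃ h ∈ intermediateEntropies φ, |t - h| ≤ ε := by
  obtain ⟨N, hN, hNε⟩ : ∃ N : ℕ, 0 < N ∧ Real.log (N + 1 : ℕ) / N ≤ ε := by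
    have h1 : Tendsto (fun N : ℕ => Real.log (N + 1 : ℕ) / N) atTop (𝓝 0) := by
      have h2 : Tendsto (fun x : ℝ => Real.log x / (1 * x + (-1))) atTop (𝓝 0) := by
        simpa using Real.tendsto_pow_log_div_mul_add_atTop 1 (-1) 1 one_ne_zero
      refine (h2.comp (tendsto_natCast_atTop_atTop.comp (tendsto_add_atTop_nat 1))).congr
        fun N => ?_
      simp
    obtain ⟨N, h2, h3⟩ := ((h1.eventually_le_const hε).and (eventually_gt_atTop 0)).exists
    exact ⟨N, h3, h2⟩
  obtain ⟨L, hL, hLε⟩ : ∃ L : ℕ, 0 < L ∧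
      Real.log (N * (Nat.card A + 1) ^ N : ℕ) / L ≤ ε := by
    obtain ⟨L, h2, h3⟩ := (((tendsto_const_div_atTop_nhds_zero_nat
      (Real.log (N * (Nat.card A + 1) ^ N : ℕ))).eventually_le_const hε).and
      (eventually_gt_atTop 0)).exists
    exact ⟨L, h3, h2⟩
  -- If no value is within `ε` of `t`, steps of size at most `ε` cannot cross `t`, so all values
  -- stay below it; the full set of words then contradicts `t ≤ h(X)`.
  by_contra! hcon
  have hlt : ∀ S : Set (Fin L → A), S ⊆ {w | ¬ HasPeriodLT N w} →
      entropy (markedShift hφ.1 S) ≤ t := by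
    intro S hS
    induction S, S.toFinite using Set.Finite.induction_on with
    | empty => exact (entropy_markedShift_empty_le hφ.1).trans hY
    | @insert w S _ _ ih =>
      have h1 := ih ((Set.subset_insert _ _).trans hS)
      have h2 := entropy_markedShift_insert_le hφ.1 hN S (hS (Set.mem_insert w S))
      by_contra! h3
      refine (hcon _ (entropy_markedShift_mem hφ (insert w S))).not_ge ?_
      rw [abs_le]
      constructor <;> linarith
  have h1 := hlt _ subset_rfl
  have h2 := entropy_le_entropy_markedShift (N := N) hφ.1 hN hL
  refine (hcon _ (entropy_markedShift_mem hφ {w : Fin L → A | ¬ HasPeriodLT N w})).not_ge ?_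
  rw [abs_le]
  constructor <;> linarith

end SymbDyn

theorem mainTheorem2 {A B : Type u} [Finite A] [Finite B]
    [TopologicalSpace A] [DiscreteTopology A] [TopologicalSpace B] [DiscreteTopology B]
    (X : SymbDyn.ShiftSpace A) (Y : SymbDyn.ShiftSpace B)
    (hX : SymbDyn.IsSofic X) (hY : SymbDyn.IsSofic Y)
    (φ : X.carrier → Y.carrier) (hφ : SymbDyn.IsFactorCode φ) :
    SymbDyn.intermediateEntropies φ ⊆ Set.Icc (SymbDyn.entropy Y) (SymbDyn.entropy X) ∧
      Set.Icc (SymbDyn.entropy Y) (SymbDyn.entropy X) ⊆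
        closure (SymbDyn.intermediateEntropies φ) := by
  refine ⟨?_, fun t ht => ?_⟩
  · rintro _ ⟨C, _, _, _, Z, φ₁, φ₂, h₁, h₂, -, rfl⟩
    exact ⟨h₂.entropy_le, h₁.entropy_le⟩
  · refine Metric.mem_closure_iff.2 fun ε hε => ?_
    obtain ⟨h, hh, hth⟩ := SymbDyn.exists_intermediateEntropy_near hφ (half_pos hε) ht.1 ht.2
    exact ⟨h, hh, by rw [Real.dist_eq]; linarith⟩
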